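/- Let $P$ be a poset, viewed as a category with a unique morphism $x\to y$ when $x\le y$. A presheaf on $P$ is a functor $F:P^{\mathrm{op}}\to\mathbf{Ab}$; for $x\le y$ write $F^y_x:F(y)\to F(x)$ for the induced map. Let $S^*(P;F)$ be the cochain complex with $S^n(P;F)=\prod_{\sigma}F(\sigma_n)$, the product over all $n$-simplices $\sigma=(\sigma_n\le\dots\le\sigma_0)$ of the nerve of $P$, and with differential $$ds\cdot\sigma=\sum_{i=0}^{n-1}(-1)^i\,s\cdot d_i\sigma+(-1)^nF^{\sigma_{n-1}}_{\sigma_n}(s\cdot d_n\sigma)\qquad(s\in S^{n-1}(P;F)),$$ where $d_i$ omits $\sigma_i$. Put $HS^*(P;F)=H(S^*(P;F))$; this is the cohomology of $P$ with coefficients in $F$ (well known to be the higher limits $\varprojlim^*_PF$). For sub-posets $B\subseteq A$ of $P$ let $S^*(A,B;F)$ be the kernel of the restriction $S^*(A;F|_A)\to S^*(B;F|_B)$ and $HS^*(A,B;F)$ its cohomology. Suppose that $P$ is graded with a corank function: a function $rk:P\to\mathbb Z$ is fixed, with $rk(x)<rk(y)$ if $x<y$ and $rk(y)=rk(x)+1$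 if $y$ covers $x$, which is bounded above, with maximum $r$. Let $|x|=r-rk(x)$ and $P^k=\{x\in P: |x|\le k\}$. The cellular cochain complex $C^*(P;F)$ has $C^n(P;F)=HS^n(P^n,P^{n-1};F)$, and its differential $C^{n}\to C^{n+1}$ is the coboundary map $HS^{n}(P^{n},P^{n-1};F)\to HS^{n+1}(P^{n+1},P^{n};F)$ of the long exact sequence of the triple $P^{n-1}\subseteq P^{n}\subseteq P^{n+1}$. Its cohomology is the cellular cohomology $HC^*(P;F)$. Theorem. Suppose moreover that $P$ is locally finite (every element of $P$ is covered by only finitely many elements) and cellular, i.e. $HS^i(P^n,P^{n-1};F)=0$ for all $i\ne n$ and every presheaf $F$. Then for every $n$ there is an isomorphism $$HS^n(P;F)\cong HC^n(P;F),$$ natural in the presheaf $F$ on $P$. -/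

import Mathlib

open CategoryTheory CategoryTheory.Limits Opposite

universe u w

namespace PosetCohomology

noncomputable section

section Cochains

variable {P : Type u} [PartialOrder P]

/-- The `n`-simplices `σ_n ≤ ⋯ ≤ σ_0` of the nerve of the sub-poset `A` of `P`
(`A = Set.univ` gives the nerve of `P` itself). -/
@[ext]
structure Simplex (A : Set P) (n : ℕ) : Type u where
  /-- The vertex `σ_i`. -/
  vertex : Fin (n + 1) → P
  antitone : Antitone vertex
  mem : ∀ i, vertex i ∈ A

/-- The vertex `σ_n`, the smallest element of the simplex. -/
def Simplex.bot {A : Set P} {n : ℕ} (σ : Simplex A n) : P := σ.vertex (Fin.last n)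

/-- The face map `d_i`, omitting the vertex `σ_i`. -/
def Simplex.face {A : Set P} {n : ℕ} (i : Fin (n + 2)) (σ : Simplex A (n + 1)) : Simplex A n :=
  ⟨fun j => σ.vertex (i.succAbove j),
    fun _ _ h => σ.antitone ((Fin.strictMono_succAbove i).monotone h), fun _ => σ.mem _⟩

/-- A simplex of `B` is a simplex of every larger sub-poset `A`. -/
def Simplex.incl {A B : Set P} (h : B ⊆ A) {n : ℕ} (σ : Simplex B n) : Simplex A n :=
  ⟨σ.vertex, σ.antitone, fun i => h (σ.mem i)⟩

lemma Simplex.bot_le_bot_face {A : Set P} {n : ℕ} (i : Fin (n + 2)) (σ : Simplex A (n + 1)) :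
    σ.bot ≤ (σ.face i).bot :=
  σ.antitone (Fin.le_last _)

variable (F : Pᵒᵖ ⥤ AddCommGrpCat.{w})

/-- The homomorphism `F(y) → F(x)` induced by `x ≤ y`. -/
def restr {x y : P} (h : x ≤ y) : F.obj (op y) →+ F.obj (op x) :=
  (F.map (homOfLE h).op).hom

/-- The cochain group `S^n(A; F) = ∏_σ F(σ_n)`, the product over the `n`-simplices of `A`. -/
abbrev Cochain (A : Set P) (n : ℕ) : Type (max u w) :=
  ∀ σ : Simplex A n, F.obj (op σ.bot)

/-- The differential `S^n(A; F) → S^{n+1}(A; F)`,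
`(d s)·σ = ∑ i, (-1)^i • s·(d_i σ)`. Each summand is carried to `F(σ_{n+1})` along
`σ_{n+1} ≤ (d_i σ)_n`, which is an equality unless `i = n + 1`. -/
def diff (A : Set P) (n : ℕ) : Cochain F A n →+ Cochain F A (n + 1) where
  toFun s σ := ∑ i : Fin (n + 2),
    (-1 : ℤ) ^ (i : ℕ) • restr F (σ.bot_le_bot_face i) (s (σ.face i))
  map_zero' := by
    funext σ
    simp
  map_add' s t := by
    funext σ
    simp [Finset.sum_add_distrib, smul_add]

/-- The group `S^n(A, B; F)` of relative cochains of a pair `B ⊆ A`: the kernel of the pull-back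
`S^n(A; F) → S^n(B; F)`, i.e. the cochains vanishing on all simplices that lie in `B`. -/
def relCochain (A B : Set P) (n : ℕ) : AddSubgroup (Cochain F A n) where
  carrier := {s | ∀ σ : Simplex A n, (∀ i, σ.vertex i ∈ B) → s σ = 0}
  zero_mem' := fun _ _ => rfl
  add_mem' := fun {s t} hs ht σ hσ => by
    rw [Pi.add_apply, hs σ hσ, ht σ hσ, add_zero]
  neg_mem' := fun {s} hs σ hσ => by
    rw [Pi.neg_apply, hs σ hσ, neg_zero]

lemma restr_restr {x y z : P} (h : x ≤ y) (h' : y ≤ z) (a : F.obj (op z)) :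
    restr F h (restr F h' a) = restr F (h.trans h') a := by
  have := F.map_comp (homOfLE h').op (homOfLE h).op
  have h2 := congrArg (fun f => f.hom a) this
  exact h2.symm

lemma restr_congr {A : Set P} {n : ℕ} (s : Cochain F A n) {x : P} {σ τ : Simplex A n}
    (e : σ = τ) (h : x ≤ σ.bot) (h' : x ≤ τ.bot) :
    restr F h (s σ) = restr F h' (s τ) := by
  subst e
  rfl

lemma face_face {A : Set P} {n : ℕ} (σ : Simplex A (n + 2)) {i : Fin (n + 2)} {j : Fin (n + 3)}
    (H : (j : ℕ) ≤ i) :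
    (σ.face i.succ).face (j.castLT (lt_of_le_of_lt H i.2)) = (σ.face j).face i := by
  apply Simplex.ext
  funext k
  change σ.vertex _ = σ.vertex _
  congr 1
  apply Fin.ext
  simp only [Fin.succAbove, Fin.lt_def, Fin.val_castSucc, Fin.val_castLT, Fin.val_succ]
  split_ifs <;> simp_all <;> omega

lemma diff_diff (A : Set P) (n : ℕ) (s : Cochain F A n) :
    diff F A (n + 1) (diff F A n s) = 0 := by
  funext σ
  change ∑ j : Fin (n + 3), (-1 : ℤ) ^ (j : ℕ) • restr F (σ.bot_le_bot_face j)
    (∑ i : Fin (n + 2), (-1 : ℤ) ^ (i : ℕ) •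
      restr F ((σ.face j).bot_le_bot_face i) (s ((σ.face j).face i))) = 0
  simp only [map_sum, map_zsmul, Finset.smul_sum, restr_restr, smul_smul]
  rw [Finset.sum_comm, ← Finset.sum_product']
  let Q := Fin (n + 2) × Fin (n + 3)
  let S : Finset Q := {ij : Q | (ij.2 : ℕ) ≤ (ij.1 : ℕ)}
  rw [Finset.univ_product_univ, ← Finset.sum_add_sum_compl S, ← eq_neg_iff_add_eq_zero,
    ← Finset.sum_neg_distrib]
  let φ : ∀ ij : Q, ij ∈ S → Q := fun ij hij =>
    (Fin.castLT ij.2 (lt_of_le_of_lt (Finset.mem_filter.mp hij).right (Fin.is_lt ij.1)), ij.1.succ)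
  apply Finset.sum_bij φ
  · intro ij hij
    simp_rw [S, φ, Finset.compl_filter, Finset.mem_filter_univ, Fin.val_succ,
      Fin.val_castLT] at hij ⊢
    lia
  · rintro ⟨i, j⟩ hij ⟨i', j'⟩ hij' h
    rw [Prod.mk_inj]
    exact ⟨by simpa [φ] using! congr_arg Prod.snd h,
      by simpa [φ, Fin.castSucc_castLT] using! congr_arg Fin.castSucc (congr_arg Prod.fst h)⟩
  · rintro ⟨i', j'⟩ hij'
    simp_rw [S, Finset.compl_filter, Finset.mem_filter_univ, not_le] at hij'
    refine ⟨(j'.pred <| ?_, Fin.castSucc i'), ?_, ?_⟩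
    · rintro rfl
      simp only [Fin.val_zero, not_lt_zero] at hij'
    · simpa [S] using! Nat.le_sub_one_of_lt hij'
    · simp only [φ, Fin.castLT_castSucc, Fin.succ_pred]
  · rintro ⟨i, j⟩ hij
    have H : (j : ℕ) ≤ i := (Finset.mem_filter.mp hij).right
    rw [← neg_smul]
    congr 1
    · simp only [φ, Fin.val_succ, Fin.val_castLT, pow_succ]
      ring
    · exact restr_congr F s (face_face σ H).symm _ _

lemma diff_mem {A B : Set P} {n : ℕ} {s : Cochain F A n} (hs : s ∈ relCochain F A B n) :
    diff F A n s ∈ relCochain F A B (n + 1) := by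
  intro σ hσ
  change ∑ i : Fin (n + 2), (-1 : ℤ) ^ (i : ℕ) • restr F (σ.bot_le_bot_face i) (s (σ.face i)) = 0
  refine Finset.sum_eq_zero fun i _ => ?_
  rw [hs (σ.face i) fun j => hσ _, map_zero, smul_zero]

/-- The differential of the relative cochains. -/
def relDiff (A B : Set P) (n : ℕ) : relCochain F A B n →+ relCochain F A B (n + 1) :=
  ((diff F A n).comp (relCochain F A B n).subtype).codRestrict _ fun s => diff_mem F s.2

end Cochains

section Complexes

variable {P : Type u} [PartialOrder P]

/-- The cochain complex `S^*(P; F)`. -/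
def complexObj (F : Pᵒᵖ ⥤ AddCommGrpCat.{w}) : CochainComplex AddCommGrpCat.{max u w} ℕ :=
  CochainComplex.of (fun n => AddCommGrpCat.of (Cochain F Set.univ n))
    (fun n => AddCommGrpCat.ofHom (diff F Set.univ n))
    (fun n => by
      refine AddCommGrpCat.hom_ext (AddMonoidHom.ext fun s => ?_)
      exact diff_diff F Set.univ n s)

/-- The relative cochain complex `S^*(A, B; F)`. -/
def relComplexObj (A B : Set P) (F : Pᵒᵖ ⥤ AddCommGrpCat.{w}) :
    CochainComplex AddCommGrpCat.{max u w} ℕ :=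
  CochainComplex.of (fun n => AddCommGrpCat.of (relCochain F A B n))
    (fun n => AddCommGrpCat.ofHom (relDiff F A B n))
    (fun n => by
      refine AddCommGrpCat.hom_ext (AddMonoidHom.ext fun s => ?_)
      exact Subtype.ext (diff_diff F A n s.1))

variable {F G : Pᵒᵖ ⥤ AddCommGrpCat.{w}}

lemma restr_naturality (κ : F ⟶ G) {x y : P} (h : x ≤ y) (a : F.obj (op y)) :
    restr G h ((κ.app (op y)).hom a) = (κ.app (op x)).hom (restr F h a) := by
  have := congrArg (fun f => f.hom a) (κ.naturality (homOfLE h).op)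
  exact this.symm

/-- The map `κ_* : S^n(A; F) → S^n(A; G)` induced by a morphism of presheaves. -/
def cochainMap (κ : F ⟶ G) (A : Set P) (n : ℕ) : Cochain F A n →+ Cochain G A n where
  toFun s σ := (κ.app (op σ.bot)).hom (s σ)
  map_zero' := by
    funext σ
    simp
  map_add' s t := by
    funext σ
    simp

lemma cochainMap_diff (κ : F ⟶ G) (A : Set P) (n : ℕ) (s : Cochain F A n) :
    diff G A n (cochainMap κ A n s) = cochainMap κ A (n + 1) (diff F A n s) := by
  funext σ
  change ∑ i : Fin (n + 2), (-1 : ℤ) ^ (i : ℕ) • restr G (σ.bot_le_bot_face i)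
    ((κ.app _).hom (s (σ.face i))) = (κ.app _).hom (∑ i : Fin (n + 2), (-1 : ℤ) ^ (i : ℕ) •
      restr F (σ.bot_le_bot_face i) (s (σ.face i)))
  simp only [map_sum, map_zsmul, restr_naturality]

/-- The map `κ_* : S^n(A, B; F) → S^n(A, B; G)` induced by a morphism of presheaves. -/
def relCochainMap (κ : F ⟶ G) (A B : Set P) (n : ℕ) :
    relCochain F A B n →+ relCochain G A B n :=
  ((cochainMap κ A n).comp (relCochain F A B n).subtype).codRestrict _ fun s σ hσ => by
    change (κ.app _).hom (s.1 σ) = 0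
    rw [s.2 σ hσ, map_zero]

/-- The functor `F ↦ S^*(P; F)`. -/
def complex (P : Type u) [PartialOrder P] :
    (Pᵒᵖ ⥤ AddCommGrpCat.{w}) ⥤ CochainComplex AddCommGrpCat.{max u w} ℕ where
  obj F := complexObj F
  map κ := CochainComplex.ofHom (fun n => AddCommGrpCat.ofHom (cochainMap κ Set.univ n))
    (fun n => by
      dsimp only [complexObj]
      erw [CochainComplex.of_d, CochainComplex.of_d]
      refine AddCommGrpCat.hom_ext (AddMonoidHom.ext fun s => ?_)
      exact cochainMap_diff κ Set.univ n s)
  map_id _ := rfl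
  map_comp _ _ := rfl

/-- The functor `F ↦ S^*(A, B; F)`. -/
def relComplex (A B : Set P) :
    (Pᵒᵖ ⥤ AddCommGrpCat.{w}) ⥤ CochainComplex AddCommGrpCat.{max u w} ℕ where
  obj F := relComplexObj A B F
  map κ := CochainComplex.ofHom (fun n => AddCommGrpCat.ofHom (relCochainMap κ A B n))
    (fun n => by
      dsimp only [relComplexObj]
      erw [CochainComplex.of_d, CochainComplex.of_d]
      refine AddCommGrpCat.hom_ext (AddMonoidHom.ext fun s => ?_)
      exact Subtype.ext (cochainMap_diff κ A n s.1))
  map_id _ := rfl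
  map_comp _ _ := rfl

/-- `HS^n(P; F)`, the `n`-th cohomology of `P` with coefficients in the presheaf `F`, as a functor
of `F`. -/
def HS (P : Type u) [PartialOrder P] (n : ℕ) :
    (Pᵒᵖ ⥤ AddCommGrpCat.{w}) ⥤ AddCommGrpCat.{max u w} :=
  complex P ⋙ HomologicalComplex.homologyFunctor _ _ n

/-- `HS^n(A, B; F)`, the `n`-th relative cohomology of the pair `B ⊆ A` of sub-posets of `P`, as a
functor of `F`. -/
def relHS (A B : Set P) (n : ℕ) :
    (Pᵒᵖ ⥤ AddCommGrpCat.{w}) ⥤ AddCommGrpCat.{max u w} :=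
  relComplex A B ⋙ HomologicalComplex.homologyFunctor _ _ n

end Complexes

section Triple

variable {P : Type u} [PartialOrder P] (F : Pᵒᵖ ⥤ AddCommGrpCat.{w})

/-- The pull-back `S^n(A, C; F) → S^n(B, D; F)` along an inclusion of pairs `(B, D) ⊆ (A, C)`. -/
def pullbackCochain {A B C D : Set P} (h : B ⊆ A) (h' : D ⊆ C) (n : ℕ) :
    relCochain F A C n →+ relCochain F B D n where
  toFun s := ⟨fun σ => s.1 (σ.incl h), fun σ hσ => s.2 (σ.incl h) fun i => h' (hσ i)⟩
  map_zero' := rfl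
  map_add' _ _ := rfl

/-- The pull-back, as a map of cochain complexes. -/
def pullbackMap {A B C D : Set P} (h : B ⊆ A) (h' : D ⊆ C) :
    (relComplex A C).obj F ⟶ (relComplex B D).obj F :=
  CochainComplex.ofHom (fun n => AddCommGrpCat.ofHom (pullbackCochain F h h' n))
    (fun n => by
      dsimp only [relComplex, relComplexObj]
      erw [CochainComplex.of_d, CochainComplex.of_d]
      refine AddCommGrpCat.hom_ext (AddMonoidHom.ext fun s => ?_)
      rfl)

/-- The pull-back `HS^n(A, C; F) → HS^n(B, D; F)`. -/
def pullbackHS {A B C D : Set P} (h : B ⊆ A) (h' : D ⊆ C) (n : ℕ) :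
    (relHS A C n).obj F ⟶ (relHS B D n).obj F :=
  HomologicalComplex.homologyMap (pullbackMap F h h') n

variable {A B C : Set P} (hBA : B ⊆ A) (hCB : C ⊆ B)

/-- The sequence `0 → S^*(A, B; F) → S^*(A, C; F) → S^*(B, C; F) → 0` of a triple
`C ⊆ B ⊆ A` of sub-posets. -/
def tripleSeq : ShortComplex (CochainComplex AddCommGrpCat.{max u w} ℕ) where
  X₁ := (relComplex A B).obj F
  X₂ := (relComplex A C).obj F
  X₃ := (relComplex B C).obj F
  f := pullbackMap F subset_rfl hCB
  g := pullbackMap F hBA subset_rfl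
  zero := by
    refine HomologicalComplex.hom_ext _ _ fun n =>
      AddCommGrpCat.hom_ext (AddMonoidHom.ext fun s => ?_)
    refine Subtype.ext (funext fun σ => ?_)
    exact s.2 (σ.incl hBA) σ.mem

lemma pullbackCochain_surjective {A B C : Set P} (hBA : B ⊆ A) (hCB : C ⊆ B) (n : ℕ) :
    Function.Surjective (pullbackCochain F hBA (subset_rfl : C ⊆ C) n) := by
  classical
  intro t
  refine ⟨⟨fun σ => if h : ∀ i, σ.vertex i ∈ B then t.1 ⟨σ.vertex, σ.antitone, h⟩ else 0,
    fun σ hσ => ?_⟩, ?_⟩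
  · have h : ∀ i, σ.vertex i ∈ B := fun i => hCB (hσ i)
    exact (dif_pos h).trans (t.2 ⟨σ.vertex, σ.antitone, h⟩ hσ)
  · refine Subtype.ext (funext fun σ => ?_)
    change dite _ _ _ = _
    exact dif_pos σ.mem

lemma tripleSeq_shortExact : (tripleSeq F hBA hCB).ShortExact := by
  refine HomologicalComplex.shortExact_of_degreewise_shortExact _ fun n => ?_
  refine { exact := ?_, mono_f := ?_, epi_g := ?_ }
  · rw [ShortComplex.ab_exact_iff]
    intro s hs
    refine ⟨⟨s.1, fun σ hσ => ?_⟩, Subtype.ext rfl⟩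
    exact congrFun (congrArg Subtype.val hs) (⟨σ.vertex, σ.antitone, hσ⟩ : Simplex B n)
  · refine (AddCommGrpCat.mono_iff_injective _).2 fun s t hst => ?_
    have h : (s : relCochain F A B n).1 = (t : relCochain F A B n).1 :=
      congrArg (fun v : relCochain F A C n => v.1) hst
    exact Subtype.ext h
  · exact (AddCommGrpCat.epi_iff_surjective _).2 (pullbackCochain_surjective F hBA hCB n)

/-- The coboundary `δ : HS^n(B, C; F) → HS^{n+1}(A, B; F)` in the long exact sequence of the
triple `C ⊆ B ⊆ A`. -/
def coboundary (n : ℕ) : (relHS B C n).obj F ⟶ (relHS A B (n + 1)).obj F :=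
  (tripleSeq_shortExact F hBA hCB).δ n (n + 1) rfl

lemma coboundary_naturality {F G : Pᵒᵖ ⥤ AddCommGrpCat.{w}} (κ : F ⟶ G) (n : ℕ) :
    coboundary F hBA hCB n ≫ (relHS A B (n + 1)).map κ =
      (relHS B C n).map κ ≫ coboundary G hBA hCB n :=
  HomologicalComplex.HomologySequence.δ_naturality
    (S₁ := tripleSeq F hBA hCB) (S₂ := tripleSeq G hBA hCB)
    { τ₁ := (relComplex A B).map κ, τ₂ := (relComplex A C).map κ, τ₃ := (relComplex B C).map κ
      comm₁₂ := rfl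
      comm₂₃ := rfl }
    (tripleSeq_shortExact F hBA hCB) (tripleSeq_shortExact G hBA hCB) n (n + 1) rfl

lemma coboundary_comp {D : Set P} (hDC : D ⊆ C) (n : ℕ) :
    coboundary F hCB hDC n ≫ coboundary F hBA hCB (n + 1) = 0 := by
  have e : coboundary F hBA hCB (n + 1) =
      pullbackHS F subset_rfl (Set.empty_subset C) (n + 1) ≫
        coboundary F hBA (Set.empty_subset B) (n + 1) := by
    have := HomologicalComplex.HomologySequence.δ_naturality
      (S₁ := tripleSeq F hBA hCB) (S₂ := tripleSeq F hBA (Set.empty_subset B))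
      { τ₁ := 𝟙 _
        τ₂ := pullbackMap F subset_rfl (Set.empty_subset C)
        τ₃ := pullbackMap F subset_rfl (Set.empty_subset C)
        comm₁₂ := rfl
        comm₂₃ := rfl }
      (tripleSeq_shortExact F hBA hCB)
      (tripleSeq_shortExact F hBA (Set.empty_subset B)) (n + 1) (n + 1 + 1) rfl
    refine Eq.trans ?_ this
    erw [HomologicalComplex.homologyMap_id, Category.comp_id]
    rfl
  have e' : coboundary F hCB hDC n =
      pullbackHS F subset_rfl (Set.empty_subset D) n ≫
        coboundary F hCB (Set.empty_subset C) n := by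
    have := HomologicalComplex.HomologySequence.δ_naturality
      (S₁ := tripleSeq F hCB hDC) (S₂ := tripleSeq F hCB (Set.empty_subset C))
      { τ₁ := 𝟙 _
        τ₂ := pullbackMap F subset_rfl (Set.empty_subset D)
        τ₃ := pullbackMap F subset_rfl (Set.empty_subset D)
        comm₁₂ := rfl
        comm₂₃ := rfl }
      (tripleSeq_shortExact F hCB hDC)
      (tripleSeq_shortExact F hCB (Set.empty_subset C)) n (n + 1) rfl
    refine Eq.trans ?_ this
    erw [HomologicalComplex.homologyMap_id, Category.comp_id]
    rfl
  have z : coboundary F hCB (Set.empty_subset C) n ≫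
      pullbackHS F subset_rfl (Set.empty_subset C) (n + 1) = 0 :=
    (tripleSeq_shortExact F hCB (Set.empty_subset C)).δ_comp n (n + 1) rfl
  rw [e, e', Category.assoc, reassoc_of% z, zero_comp, comp_zero]

end Triple

section Cellular

variable (P : Type u) [PartialOrder P] [GradeOrder ℤ P]

variable {P} in
/-- The corank `|x| = r - rk x`. The rank function `rk = grade ℤ` is strictly monotone and satisfies
`rk y = rk x + 1` if `y` covers `x`; it is meant to be bounded above, and `r` is its maximum. -/
def corank (x : P) : ℤ := sSup (Set.range (grade ℤ : P → ℤ)) - grade ℤ x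

/-- The sub-poset `P^k` of the elements of corank at most `k`. -/
def skeleton (k : ℤ) : Set P := {x | corank x ≤ k}

/-- `P^{n-1}`, for a natural number `n`. -/
def filtration (n : ℕ) : Set P := skeleton P ((n : ℤ) - 1)

lemma filtration_subset (n : ℕ) : filtration P n ⊆ filtration P (n + 1) := by
  intro x hx
  simp only [filtration, skeleton, Set.mem_ofPred_eq] at hx ⊢
  push_cast
  omega

lemma filtration_succ (n : ℕ) : filtration P (n + 1) = skeleton P n := by
  simp [filtration]

variable {P} in
/-- The cellular cochain complex `C^*(P; F)`: `C^n = HS^n(P^n, P^{n-1}; F)`, and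
`C^n → C^{n+1}` is the coboundary of the triple `P^{n-1} ⊆ P^n ⊆ P^{n+1}`. -/
def cellularComplexObj (F : Pᵒᵖ ⥤ AddCommGrpCat.{w}) :
    CochainComplex AddCommGrpCat.{max u w} ℕ :=
  CochainComplex.of (fun n => (relHS (filtration P (n + 1)) (filtration P n) n).obj F)
    (fun n => coboundary F (filtration_subset P (n + 1)) (filtration_subset P n) n)
    (fun n => coboundary_comp F (filtration_subset P (n + 2)) (filtration_subset P (n + 1))
      (filtration_subset P n) n)

/-- The functor `F ↦ C^*(P; F)`. -/
def cellularComplex :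
    (Pᵒᵖ ⥤ AddCommGrpCat.{w}) ⥤ CochainComplex AddCommGrpCat.{max u w} ℕ where
  obj F := cellularComplexObj F
  map κ := CochainComplex.ofHom
    (fun n => (relHS (filtration P (n + 1)) (filtration P n) n).map κ)
    (fun n => by
      dsimp only [cellularComplexObj]
      erw [CochainComplex.of_d, CochainComplex.of_d]
      exact (coboundary_naturality (filtration_subset P (n + 1)) (filtration_subset P n) κ n).symm)
  map_id F := by
    ext n : 1
    exact (relHS (filtration P (n + 1)) (filtration P n) n).map_id F
  map_comp κ κ' := by
    ext n : 1
    exact (relHS (filtration P (n + 1)) (filtration P n) n).map_comp κ κ'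

/-- `HC^n(P; F)`, the `n`-th cellular cohomology, as a functor of `F`. -/
def HC (n : ℕ) : (Pᵒᵖ ⥤ AddCommGrpCat.{w}) ⥤ AddCommGrpCat.{max u w} :=
  cellularComplex P ⋙ HomologicalComplex.homologyFunctor _ _ n

/-- `P` is cellular: `HS^i(P^n, P^{n-1}; F) = 0` for all `i ≠ n` and every presheaf `F`. -/
def IsCellular : Prop :=
  ∀ (F : Pᵒᵖ ⥤ AddCommGrpCat.{w}) (n i : ℕ), i ≠ n →
    IsZero ((relHS (skeleton P n) (skeleton P ((n : ℤ) - 1)) i).obj F)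

/-- `P` is locally finite: every element is covered by only finitely many elements. -/
def IsLocallyFinite (P : Type u) [PartialOrder P] : Prop :=
  ∀ x : P, {y : P | x ⋖ y}.Finite

end Cellular

end

end PosetCohomology

/-!
Write `F^k S^n` for the cochains in `S^n(P; F)` that vanish on `P^{k-1}` (`filtCochain`). This is a
decreasing filtration of `S^*(P; F)` by subcomplexes with layers `S^*(P^k, P^{k-1}; F)`. It starts
at `F^0 S = S`, because `P^{-1}` is empty, and it is complete, because the value of a cochain at a
simplex `σ` only depends on its class modulo `F^k S` for `k > |σ_n|`.

Cellularity says that the `k`-th layer has cohomology in degree `k` only, so any cochain of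
filtration `k` and degree `≠ k` that is a cocycle modulo `F^{k+1} S` can be moved into `F^{k+1} S`
by subtracting a coboundary (`exists_sub_diff_mem`). Doing this infinitely often and using
completeness gives `HS^n(P, P^{k-1}; F) = 0` for `n < k` (`exists_diff_eq_of_mem_filtCochain`); no
`lim^1` argument is needed.

The comparison runs through the subcomplex of adapted cochains,
`D^n = F^n S^n ∩ d⁻¹(F^{n+1} S^{n+1})` (`adaptedComplex`). It maps to `S^*(P; F)` by inclusion, and to `C^*(P; F)` by sending a cochain to
the class in `HS^n(P^n, P^{n-1}; F)` of its restriction; the latter is a chain map since the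
connecting homomorphism of a triple is computed by lifting and differentiating. Both maps are
natural in `F`. The inclusion is a quasi-isomorphism because cocycles can be pushed up the finitely
many layers below the diagonal (`isIso_homologyMap_adaptedToComplex`). The projection to the
cellular complex is surjective, and its kernel is acyclic by the vanishing above the diagonal
(`isIso_homologyMap_adaptedToCellular`).
-/

namespace PosetCohomology

noncomputable section

/-! ### Cohomology of complexes of abelian groups, elementwise -/

section Homology

variable {K L : CochainComplex AddCommGrpCat.{w} ℕ}

lemma exists_cycle (n : ℕ) (x : K.X n) (hx : K.d n (n + 1) x = 0) :
    ∃ c : K.cycles n, K.iCycles n c = x := by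
  have hx' : K.d n ((ComplexShape.up ℕ).next n) x = 0 := by
    rw [CochainComplex.next]; exact hx
  exact ⟨(K.sc n).abCyclesIso.inv ⟨x, hx'⟩,
    (K.sc n).abCyclesIso_inv_apply_iCycles ⟨x, hx'⟩⟩

lemma homologyπ_surjective (n : ℕ) : Function.Surjective (K.homologyπ n) :=
  (AddCommGrpCat.epi_iff_surjective _).1 inferInstance

lemma d_iCycles (n : ℕ) (c : K.cycles n) : K.d n (n + 1) (K.iCycles n c) = 0 :=
  ConcreteCategory.congr_hom (K.iCycles_d n (n + 1)) c

/-- The boundaries in degree `n`. In degree `0` there is no incoming differential, and only `0` is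
a boundary. -/
def IsBoundary (K : CochainComplex AddCommGrpCat.{w} ℕ) : (n : ℕ) → K.X n → Prop
  | 0, x => x = 0
  | n + 1, x => ∃ y : K.X n, K.d n (n + 1) y = x

lemma isBoundary_iff (n : ℕ) (x : K.X n) :
    IsBoundary K n x ↔ ∃ y, K.d ((ComplexShape.up ℕ).prev n) n y = x := by
  cases n with
  | zero =>
    have : K.d ((ComplexShape.up ℕ).prev 0) 0 = 0 := K.shape _ _ (by simp)
    rw [this]
    exact ⟨fun h => ⟨0, h.symm⟩, fun ⟨_, h⟩ => h.symm⟩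
  | succ n => rw [CochainComplex.prev_nat_succ]; rfl

lemma homologyπ_eq_zero_iff (n : ℕ) (c : K.cycles n) :
    K.homologyπ n c = 0 ↔ IsBoundary K n (K.iCycles n c) := by
  rw [isBoundary_iff]
  have ex := ShortComplex.exact_of_g_is_cokernel
    (ShortComplex.mk _ _ (K.toCycles_comp_homologyπ ((ComplexShape.up ℕ).prev n) n))
    (K.homologyIsCokernel _ n rfl)
  have hi : Function.Injective (K.iCycles n) :=
    (AddCommGrpCat.mono_iff_injective _).1 inferInstance
  have ht (y) : K.iCycles n (K.toCycles ((ComplexShape.up ℕ).prev n) n y) =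
      K.d ((ComplexShape.up ℕ).prev n) n y :=
    ConcreteCategory.congr_hom (K.toCycles_i _ n) y
  rw [ShortComplex.ab_exact_iff] at ex
  constructor
  · intro h
    obtain ⟨y, hy⟩ := ex c h
    exact ⟨y, (ht y).symm.trans (congrArg _ hy)⟩
  · rintro ⟨y, hy⟩
    obtain rfl : K.toCycles _ n y = c := hi ((ht y).trans hy)
    exact ConcreteCategory.congr_hom (K.toCycles_comp_homologyπ _ n) y

lemma isBoundary_of_isZero_homology {n : ℕ} (h : IsZero (K.homology n)) (x : K.X n)
    (hx : K.d n (n + 1) x = 0) : IsBoundary K n x := by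
  obtain ⟨c, rfl⟩ := exists_cycle n x hx
  rw [← homologyπ_eq_zero_iff]
  have : K.homologyπ n = 0 := h.eq_of_tgt _ _
  rw [this]
  rfl

/-- Elementwise criterion for a map of cochain complexes of abelian groups to induce an
isomorphism on cohomology. -/
lemma isIso_homologyMap (φ : K ⟶ L) (n : ℕ)
    (surj : ∀ y : L.X n, L.d n (n + 1) y = 0 →
      ∃ x : K.X n, K.d n (n + 1) x = 0 ∧ IsBoundary L n (φ.f n x - y))
    (inj : ∀ x : K.X n, K.d n (n + 1) x = 0 → IsBoundary L n (φ.f n x) → IsBoundary K n x) :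
    IsIso (HomologicalComplex.homologyMap φ n) := by
  have hπ (c : K.cycles n) : HomologicalComplex.homologyMap φ n (K.homologyπ n c) =
      L.homologyπ n (HomologicalComplex.cyclesMap φ n c) :=
    ConcreteCategory.congr_hom (HomologicalComplex.homologyπ_naturality φ n) c
  have hi (c : K.cycles n) : L.iCycles n (HomologicalComplex.cyclesMap φ n c) =
      φ.f n (K.iCycles n c) :=
    ConcreteCategory.congr_hom (HomologicalComplex.cyclesMap_i φ n) c
  have : Mono (HomologicalComplex.homologyMap φ n) := by
    rw [AddCommGrpCat.mono_iff_injective, injective_iff_map_eq_zero]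
    intro z hz
    obtain ⟨c, rfl⟩ := homologyπ_surjective n z
    rw [hπ, homologyπ_eq_zero_iff, hi] at hz
    exact (homologyπ_eq_zero_iff n c).2 (inj _ (d_iCycles n c) hz)
  have : Epi (HomologicalComplex.homologyMap φ n) := by
    rw [AddCommGrpCat.epi_iff_surjective]
    intro z
    obtain ⟨c, rfl⟩ := homologyπ_surjective n z
    obtain ⟨x, hx, hb⟩ := surj _ (d_iCycles n c)
    obtain ⟨b, rfl⟩ := exists_cycle n x hx
    refine ⟨K.homologyπ n b, ?_⟩
    rw [hπ, ← sub_eq_zero, ← map_sub, homologyπ_eq_zero_iff, map_sub, hi]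
    exact hb
  exact isIso_of_mono_of_epi _

end Homology

/-! ### Relative cocycles of a pair with vanishing cohomology -/

section Pairs

variable {P : Type u} [PartialOrder P] {F : Pᵒᵖ ⥤ AddCommGrpCat.{w}}

lemma complex_d (n : ℕ) : ((complex P).obj F).d n (n + 1) =
    AddCommGrpCat.ofHom (diff F Set.univ n) :=
  CochainComplex.of_d (fun n => AddCommGrpCat.of (Cochain F Set.univ n))
    (fun n => AddCommGrpCat.ofHom (diff F Set.univ n)) n

lemma isBoundary_complex_succ_iff (n : ℕ) (s : Cochain F (Set.univ : Set P) (n + 1)) :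
    IsBoundary ((complex P).obj F) (n + 1) s ↔
      ∃ t : Cochain F (Set.univ : Set P) n, diff F _ n t = s := by
  change (∃ y, _) ↔ _
  rw [complex_d]
  rfl

lemma relComplex_d (A B : Set P) (n : ℕ) : ((relComplex A B).obj F).d n (n + 1) =
    AddCommGrpCat.ofHom (relDiff F A B n) :=
  CochainComplex.of_d (fun n => AddCommGrpCat.of (relCochain F A B n))
    (fun n => AddCommGrpCat.ofHom (relDiff F A B n)) n

/-- A relative cocycle of a pair with vanishing cohomology in that degree is zero (degree `0`). -/
lemma eq_zero_of_isZero_relHS {A B : Set P} (h : IsZero ((relHS A B 0).obj F))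
    {s : Cochain F A 0} (hs : s ∈ relCochain F A B 0) (hd : diff F A 0 s = 0) : s = 0 := by
  have := isBoundary_of_isZero_homology (K := (relComplex A B).obj F) h
    (⟨s, hs⟩ : relCochain F A B 0) (by
      rw [relComplex_d]
      exact Subtype.ext hd)
  exact congrArg Subtype.val this

lemma exists_diff_eq_of_isZero_relHS {A B : Set P} {n : ℕ}
    (h : IsZero ((relHS A B (n + 1)).obj F))
    {s : Cochain F A (n + 1)} (hs : s ∈ relCochain F A B (n + 1)) (hd : diff F A (n + 1) s = 0) :
    ∃ t ∈ relCochain F A B n, diff F A n t = s := by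
  have := isBoundary_of_isZero_homology (K := (relComplex A B).obj F) h
    (⟨s, hs⟩ : relCochain F A B (n + 1)) (by
      rw [relComplex_d]
      exact Subtype.ext hd)
  obtain ⟨t, ht⟩ := this
  rw [relComplex_d] at ht
  exact ⟨Subtype.val (p := (· ∈ relCochain F A B n)) t, t.2, congrArg Subtype.val ht⟩

end Pairs

/-! ### The filtration by the skeleta -/

section Filtration

variable {P : Type u} [PartialOrder P] [GradeOrder ℤ P]

lemma filtration_mono : Monotone (filtration P) :=
  monotone_nat_of_le_succ (filtration_subset P)

lemma corank_anti {x y : P} (h : x ≤ y) : corank y ≤ corank x :=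
  sub_le_sub_left (grade_strictMono.monotone h) _

lemma mem_filtration_of_le {k : ℕ} {x y : P} (h : x ≤ y) (hx : x ∈ filtration P k) :
    y ∈ filtration P k :=
  (corank_anti h).trans hx

lemma mem_filtration_toNat (x : P) : x ∈ filtration P (corank x + 1).toNat := by
  change corank x ≤ ((corank x + 1).toNat : ℤ) - 1
  lia

lemma filtration_zero (hbdd : BddAbove (Set.range (grade ℤ : P → ℤ))) :
    filtration P 0 = ∅ := by
  refine Set.eq_empty_of_forall_notMem fun x hx => ?_
  have h : corank x ≤ ((0 : ℕ) : ℤ) - 1 := hx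
  have h' := le_csSup hbdd (Set.mem_range_self x)
  rw [corank] at h
  lia

variable (F : Pᵒᵖ ⥤ AddCommGrpCat.{w})

/-- The subgroup `S^n(P, P^{k-1}; F)` of `S^n(P; F)`: the decreasing filtration of the cochain
complex by the cochains that vanish on the skeleta. -/
abbrev filtCochain (k n : ℕ) : AddSubgroup (Cochain F (Set.univ : Set P) n) :=
  relCochain F Set.univ (filtration P k) n

variable {F}

lemma mem_filtCochain_iff {k n : ℕ} {s : Cochain F (Set.univ : Set P) n} :
    s ∈ filtCochain F k n ↔ ∀ σ, σ.bot ∈ filtration P k → s σ = 0 :=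
  ⟨fun h σ hσ => h σ fun i => mem_filtration_of_le (σ.antitone (Fin.le_last i)) hσ,
    fun h σ hσ => h σ (hσ _)⟩

lemma filtCochain_anti {k l : ℕ} (h : k ≤ l) (n : ℕ) : filtCochain F l n ≤ filtCochain F k n :=
  fun _ hs σ hσ => hs σ fun i => filtration_mono h (hσ i)

lemma mem_filtCochain_zero (hbdd : BddAbove (Set.range (grade ℤ : P → ℤ))) {n : ℕ}
    (s : Cochain F (Set.univ : Set P) n) : s ∈ filtCochain F 0 n := by
  rw [mem_filtCochain_iff, filtration_zero hbdd]
  exact fun _ h => h.elim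

variable (F) in
/-- The restriction `S^n(P, P^{k-1}; F) → S^n(P^k, P^{k-1}; F)`. -/
def restrictLayer (k n : ℕ) :
    filtCochain F k n →+ relCochain F (filtration P (k + 1)) (filtration P k) n :=
  pullbackCochain F (Set.subset_univ _) subset_rfl n

lemma restrictLayer_surjective (k n : ℕ) : Function.Surjective (restrictLayer F k n) :=
  pullbackCochain_surjective F (Set.subset_univ _) (filtration_subset P k) n

lemma restrictLayer_eq_zero_iff {k n : ℕ} (s : filtCochain F k n) :
    restrictLayer F k n s = 0 ↔ s.1 ∈ filtCochain F (k + 1) n :=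
  ⟨fun h σ hσ => congrFun (congrArg Subtype.val h)
      (⟨σ.vertex, σ.antitone, hσ⟩ : Simplex (filtration P (k + 1)) n),
    fun h => Subtype.ext (funext fun σ => h (σ.incl (Set.subset_univ _)) σ.mem)⟩

lemma relDiff_restrictLayer {k n : ℕ} (s : filtCochain F k n) :
    relDiff F _ _ n (restrictLayer F k n s) =
      restrictLayer F k (n + 1) (relDiff F Set.univ (filtration P k) n s) := rfl

lemma IsCellular.isZero (hcell : IsCellular.{u, w} P) {k i : ℕ} (h : i ≠ k) :
    IsZero ((relHS (filtration P (k + 1)) (filtration P k) i).obj F) := by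
  rw [filtration_succ]
  exact hcell F k i h

/-- Degree `0` form of `exists_sub_diff_mem`. -/
lemma mem_filtCochain_succ_of_diff_mem (hcell : IsCellular.{u, w} P) {k : ℕ} (hk : 0 ≠ k)
    {s : Cochain F (Set.univ : Set P) 0} (hs : s ∈ filtCochain F k 0)
    (hd : diff F _ 0 s ∈ filtCochain F (k + 1) 1) : s ∈ filtCochain F (k + 1) 0 := by
  rw [← restrictLayer_eq_zero_iff ⟨s, hs⟩]
  refine Subtype.ext (eq_zero_of_isZero_relHS (hcell.isZero hk) (restrictLayer F k 0 ⟨s, hs⟩).2 ?_)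
  exact congrArg Subtype.val
    ((restrictLayer_eq_zero_iff (⟨diff F _ 0 s, diff_mem F hs⟩ : filtCochain F k 1)).2 hd)

/-- Since the cohomology of the layer `(P^k, P^{k-1})` vanishes away from degree `k`, a cochain of
filtration `k` that is a cocycle on `P^k` can be corrected by a coboundary to have filtration
`k + 1`. -/
lemma exists_sub_diff_mem (hcell : IsCellular.{u, w} P) {k n : ℕ} (hk : n + 1 ≠ k)
    {s : Cochain F (Set.univ : Set P) (n + 1)} (hs : s ∈ filtCochain F k (n + 1))
    (hd : diff F _ (n + 1) s ∈ filtCochain F (k + 1) (n + 2)) :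
    ∃ t ∈ filtCochain F k n, s - diff F _ n t ∈ filtCochain F (k + 1) (n + 1) := by
  obtain ⟨t, ht, e⟩ := exists_diff_eq_of_isZero_relHS (hcell.isZero hk)
    (restrictLayer F k (n + 1) ⟨s, hs⟩).2 (congrArg Subtype.val
      ((restrictLayer_eq_zero_iff (⟨diff F _ _ s, diff_mem F hs⟩ : filtCochain F k (n + 2))).2 hd))
  obtain ⟨t', ht'⟩ := restrictLayer_surjective k n ⟨t, ht⟩
  obtain rfl : (restrictLayer F k n t').1 = t := congrArg Subtype.val ht'
  refine ⟨t'.1, t'.2, ?_⟩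
  refine (restrictLayer_eq_zero_iff
    ((⟨s, hs⟩ : filtCochain F k (n + 1)) - ⟨diff F _ n t'.1, diff_mem F t'.2⟩)).1 ?_
  rw [map_sub, sub_eq_zero]
  exact Subtype.ext e.symm

/-- The filtration is complete: a sequence of cochains whose successive differences have increasing
filtration is eventually constant at each simplex, and converges to its pointwise limit. -/
lemma exists_limit (n k : ℕ) (u : ℕ → Cochain F (Set.univ : Set P) n)
    (hu : ∀ m, u (m + 1) - u m ∈ filtCochain F (k + m) n) :
    ∃ t : Cochain F (Set.univ : Set P) n, ∀ m, t - u m ∈ filtCochain F (k + m) n := by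
  have key : ∀ m l, m ≤ l → u l - u m ∈ filtCochain F (k + m) n := by
    intro m l h
    induction l, h using Nat.le_induction with
    | base => rw [sub_self]; exact zero_mem _
    | succ l h ih =>
      rw [← sub_add_sub_cancel (u (l + 1)) (u l) (u m)]
      exact add_mem (filtCochain_anti (by lia) n (hu l)) ih
  -- `σ` lies in `filtration P k` as soon as `k ≥ |σ_n| + 1`, so this is a stable value.
  refine ⟨fun σ => u (corank σ.bot + 1).toNat σ, fun m => ?_⟩
  rw [mem_filtCochain_iff]
  intro σ hσ
  have h1 := mem_filtration_toNat σ.bot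
  set N := (corank σ.bot + 1).toNat
  change u N σ - u m σ = 0
  rcases le_total m N with h | h
  · exact (mem_filtCochain_iff.1 (key m N h)) σ hσ
  · rw [← neg_eq_zero, neg_sub]
    exact (mem_filtCochain_iff.1 (key N m h)) σ (filtration_mono (by lia) h1)

/-- The filtration is Hausdorff. -/
lemma eq_zero_of_forall_mem {n k : ℕ} {s : Cochain F (Set.univ : Set P) n}
    (h : ∀ m, s ∈ filtCochain F (k + m) n) : s = 0 := by
  funext σ
  exact mem_filtCochain_iff.1 (h (corank σ.bot + 1).toNat) σ
    (filtration_mono (by lia) (mem_filtration_toNat σ.bot))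

/-- `HS^0(P, P^{k-1}; F) = 0` for `k > 0`. -/
lemma eq_zero_of_mem_filtCochain (hcell : IsCellular.{u, w} P) {k : ℕ} (hk : 0 < k)
    {s : Cochain F (Set.univ : Set P) 0} (hs : s ∈ filtCochain F k 0)
    (hd : diff F _ 0 s = 0) : s = 0 := by
  refine eq_zero_of_forall_mem (k := k) fun m => ?_
  induction m with
  | zero => exact hs
  | succ m ih =>
    exact mem_filtCochain_succ_of_diff_mem hcell (by lia) ih (hd ▸ zero_mem _)

/-- `HS^{n+1}(P, P^{k-1}; F) = 0` for `k > n + 1`: the successive corrections of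
`exists_sub_diff_mem` have increasing filtration, so they can be summed. -/
lemma exists_diff_eq_of_mem_filtCochain (hcell : IsCellular.{u, w} P) {k n : ℕ} (hk : n + 1 < k)
    {s : Cochain F (Set.univ : Set P) (n + 1)} (hs : s ∈ filtCochain F k (n + 1))
    (hd : diff F _ (n + 1) s = 0) : ∃ t ∈ filtCochain F k n, diff F _ n t = s := by
  have step : ∀ (m : ℕ) (t : Cochain F (Set.univ : Set P) n),
      s - diff F _ n t ∈ filtCochain F (k + m) (n + 1) →
      ∃ t', t' - t ∈ filtCochain F (k + m) n ∧
        s - diff F _ n t' ∈ filtCochain F (k + m + 1) (n + 1) := by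
    intro m t h
    obtain ⟨v, hv, hv'⟩ := exists_sub_diff_mem hcell (by lia) h (by
      rw [map_sub, hd, diff_diff, sub_zero]; exact zero_mem _)
    refine ⟨t + v, by simpa using hv, ?_⟩
    rwa [map_add, ← sub_sub]
  choose! next hnext hnext' using step
  let u : ℕ → Cochain F (Set.univ : Set P) n := fun m => Nat.rec 0 next m
  have hu : ∀ m, s - diff F _ n (u m) ∈ filtCochain F (k + m) (n + 1) := by
    intro m
    induction m with
    | zero => simpa [u] using hs
    | succ m ih => exact hnext' m (u m) ih
  obtain ⟨t, ht⟩ := exists_limit n k u fun m => hnext m (u m) (hu m)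
  refine ⟨t, by simpa [u] using ht 0, ?_⟩
  rw [← sub_eq_zero]
  refine eq_zero_of_forall_mem (k := k) fun m => ?_
  have : diff F _ n t - s = diff F _ n (t - u m) - (s - diff F _ n (u m)) := by
    rw [map_sub]; abel
  rw [this]
  exact sub_mem (diff_mem F (ht m)) (hu m)

/-- Up to its degree, a cochain can be moved by a coboundary to the filtration of its
differential. -/
lemma exists_sub_diff_mem_of_diff_mem (hbdd : BddAbove (Set.range (grade ℤ : P → ℤ)))
    (hcell : IsCellular.{u, w} P) {n k : ℕ} (hk : k ≤ n + 1)
    {s : Cochain F (Set.univ : Set P) (n + 1)}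
    (hd : diff F _ (n + 1) s ∈ filtCochain F k (n + 2)) :
    ∃ t, s - diff F _ n t ∈ filtCochain F k (n + 1) := by
  induction k with
  | zero => exact ⟨0, mem_filtCochain_zero hbdd _⟩
  | succ k ih =>
    obtain ⟨t, ht⟩ := ih (by lia) (filtCochain_anti k.le_succ _ hd)
    obtain ⟨v, -, hv⟩ := exists_sub_diff_mem hcell (by lia) ht (by
      rwa [map_sub, diff_diff, sub_zero])
    exact ⟨t + v, by rwa [map_add, ← sub_sub]⟩

end Filtration

/-! ### Adapted cochains -/

section Adapted

variable {P : Type u} [PartialOrder P] [GradeOrder ℤ P] (F : Pᵒᵖ ⥤ AddCommGrpCat.{w})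

/-- The group of adapted `n`-cochains: those `s ∈ S^n(P; F)` that vanish on `P^{n-1}` and whose
differential vanishes on `P^n`. -/
def adaptedCochain (n : ℕ) : AddSubgroup (Cochain F (Set.univ : Set P) n) :=
  filtCochain F n n ⊓ (filtCochain F (n + 1) (n + 1)).comap (diff F Set.univ n)

/-- The differential of the adapted cochains. -/
def adaptedDiff (n : ℕ) : adaptedCochain F n →+ adaptedCochain F (n + 1) :=
  ((diff F Set.univ n).comp (adaptedCochain F n).subtype).codRestrict _ fun s =>
    ⟨s.2.2, by
      change diff F Set.univ (n + 1) (diff F Set.univ n s.1) ∈ filtCochain F (n + 2) (n + 2)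
      rw [diff_diff]
      exact zero_mem _⟩

/-- The complex of adapted cochains, a subcomplex of `S^*(P; F)`. -/
def adaptedComplexObj : CochainComplex AddCommGrpCat.{max u w} ℕ :=
  CochainComplex.of (fun n => AddCommGrpCat.of (adaptedCochain F n))
    (fun n => AddCommGrpCat.ofHom (adaptedDiff F n))
    (fun n => AddCommGrpCat.hom_ext (AddMonoidHom.ext fun s =>
      Subtype.ext (diff_diff F Set.univ n s.1)))

variable {F} {G : Pᵒᵖ ⥤ AddCommGrpCat.{w}}

lemma cochainMap_mem_filtCochain (κ : F ⟶ G) {k n : ℕ} {s : Cochain F (Set.univ : Set P) n}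
    (hs : s ∈ filtCochain F k n) : cochainMap κ Set.univ n s ∈ filtCochain G k n :=
  (relCochainMap κ Set.univ (filtration P k) n ⟨s, hs⟩).2

/-- The map of adapted cochains induced by a morphism of presheaves. -/
def adaptedCochainMap (κ : F ⟶ G) (n : ℕ) : adaptedCochain F n →+ adaptedCochain G n :=
  ((cochainMap κ Set.univ n).comp (adaptedCochain F n).subtype).codRestrict _ fun s =>
    ⟨cochainMap_mem_filtCochain κ s.2.1, by
      change diff G Set.univ n (cochainMap κ Set.univ n s.1) ∈ filtCochain G (n + 1) (n + 1)
      rw [cochainMap_diff]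
      exact cochainMap_mem_filtCochain κ s.2.2⟩

variable (P) in
/-- The functor sending a presheaf to its complex of adapted cochains. -/
def adaptedComplex : (Pᵒᵖ ⥤ AddCommGrpCat.{w}) ⥤ CochainComplex AddCommGrpCat.{max u w} ℕ where
  obj F := adaptedComplexObj F
  map κ := CochainComplex.ofHom (fun n => AddCommGrpCat.ofHom (adaptedCochainMap κ n))
    (fun n => by
      dsimp only [adaptedComplexObj]
      erw [CochainComplex.of_d, CochainComplex.of_d]
      refine AddCommGrpCat.hom_ext (AddMonoidHom.ext fun s => ?_)
      exact Subtype.ext (cochainMap_diff κ Set.univ n s.1))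
  map_id _ := rfl
  map_comp _ _ := rfl

lemma adaptedComplex_d (n : ℕ) : ((adaptedComplex P).obj F).d n (n + 1) =
    AddCommGrpCat.ofHom (adaptedDiff F n) :=
  CochainComplex.of_d (fun n => AddCommGrpCat.of (adaptedCochain F n))
    (fun n => AddCommGrpCat.ofHom (adaptedDiff F n)) n

lemma cellularComplex_d (n : ℕ) : ((cellularComplex P).obj F).d n (n + 1) =
    coboundary F (filtration_subset P (n + 1)) (filtration_subset P n) n :=
  CochainComplex.of_d (fun n => (relHS (filtration P (n + 1)) (filtration P n) n).obj F)
    (fun n => coboundary F (filtration_subset P (n + 1)) (filtration_subset P n) n) n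

variable (P) in
/-- The inclusion of the adapted cochains into all cochains. -/
def adaptedToComplex : adaptedComplex.{u, w} P ⟶ complex.{u, w} P where
  app F := CochainComplex.ofHom (fun n => AddCommGrpCat.ofHom (adaptedCochain F n).subtype)
    (fun n => by
      erw [complex_d, adaptedComplex_d]
      rfl)
  naturality _ _ _ := rfl

variable (F) in
/-- The restriction of adapted cochains to `S^n(P^n, P^{n-1}; F)`; it takes values in cocycles. -/
def adaptedRestrict (n : ℕ) : AddCommGrpCat.of (adaptedCochain F n) ⟶
    ((relComplex (filtration P (n + 1)) (filtration P n)).obj F).X n :=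
  AddCommGrpCat.ofHom ((restrictLayer F n n).comp (AddSubgroup.inclusion inf_le_left))

lemma adaptedRestrict_d (n : ℕ) : adaptedRestrict F n ≫
    ((relComplex (filtration P (n + 1)) (filtration P n)).obj F).d n (n + 1) = 0 := by
  rw [relComplex_d]
  refine AddCommGrpCat.hom_ext (AddMonoidHom.ext fun s => ?_)
  exact (restrictLayer_eq_zero_iff
    (⟨diff F _ n s.1, diff_mem F s.2.1⟩ : filtCochain F n (n + 1))).2 s.2.2

variable (F) in
/-- The cocycle of the layer `(P^n, P^{n-1})` given by an adapted cochain. -/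
def adaptedToCycles (n : ℕ) : AddCommGrpCat.of (adaptedCochain F n) ⟶
    ((relComplex (filtration P (n + 1)) (filtration P n)).obj F).cycles n :=
  HomologicalComplex.liftCycles _ (adaptedRestrict F n) (n + 1) (by simp) (adaptedRestrict_d n)

variable (F) in
/-- The class in `HS^n(P^n, P^{n-1}; F)` of an adapted cochain. -/
def adaptedClass (n : ℕ) : AddCommGrpCat.of (adaptedCochain F n) ⟶
    (relHS (filtration P (n + 1)) (filtration P n) n).obj F :=
  adaptedToCycles F n ≫ HomologicalComplex.homologyπ _ n

/-- The connecting map of the triple `(P^{n+1}, P^n, P^{n-1})` on the class of `s` is computed by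
the lift of `s` to `S^n(P^{n+1}, P^{n-1}; F)` that is the restriction of `s` itself. -/
lemma adaptedClass_coboundary (n : ℕ) :
    adaptedClass F n ≫ coboundary F (filtration_subset P (n + 1)) (filtration_subset P n) n =
      AddCommGrpCat.ofHom (adaptedDiff F n) ≫ adaptedClass F (n + 1) := by
  have h := ShortComplex.ShortExact.δ_eq
    (tripleSeq_shortExact F (filtration_subset P (n + 1)) (filtration_subset P n)) n (n + 1) rfl
    (adaptedRestrict F n) (adaptedRestrict_d n)
    (AddCommGrpCat.ofHom ((pullbackCochain F (Set.subset_univ (filtration P (n + 2)))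
      (subset_refl (filtration P n)) n).comp (AddSubgroup.inclusion inf_le_left))) rfl
    (AddCommGrpCat.ofHom (adaptedDiff F n) ≫ adaptedRestrict F (n + 1))
    (by
      dsimp only [tripleSeq]
      erw [relComplex_d]
      rfl) (n + 2) (by simp)
  have h' : (AddCommGrpCat.ofHom (adaptedDiff F n) ≫ adaptedToCycles F (n + 1)) ≫
      HomologicalComplex.homologyπ _ (n + 1) = _ := Category.assoc _ _ _
  rw [adaptedToCycles, HomologicalComplex.comp_liftCycles] at h'
  exact (Category.assoc _ _ _).trans (h.trans h')

lemma adaptedClass_naturality (κ : F ⟶ G) (n : ℕ) :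
    AddCommGrpCat.ofHom (adaptedCochainMap κ n) ≫ adaptedClass G n =
      adaptedClass F n ≫ (relHS (filtration P (n + 1)) (filtration P n) n).map κ := by
  have h : AddCommGrpCat.ofHom (adaptedCochainMap κ n) ≫ adaptedToCycles G n =
      adaptedToCycles F n ≫ HomologicalComplex.cyclesMap
        ((relComplex (filtration P (n + 1)) (filtration P n)).map κ) n := by
    rw [adaptedToCycles, adaptedToCycles, HomologicalComplex.comp_liftCycles,
      HomologicalComplex.liftCycles_comp_cyclesMap]
    rfl
  have h' := HomologicalComplex.homologyπ_naturality
    ((relComplex (filtration P (n + 1)) (filtration P n)).map κ) n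
  exact (Category.assoc _ _ _).symm.trans ((congrArg (· ≫ _) h).trans
    ((Category.assoc _ _ _).trans ((congrArg (adaptedToCycles F n ≫ ·) h'.symm).trans
      (Category.assoc _ _ _).symm)))

variable (P) in
/-- The map from the adapted to the cellular cochains that sends a cochain to its class. -/
def adaptedToCellular : adaptedComplex.{u, w} P ⟶ cellularComplex.{u, w} P where
  app F := CochainComplex.ofHom (adaptedClass F)
    (fun n => by
      erw [cellularComplex_d, adaptedComplex_d]
      exact adaptedClass_coboundary n)
  naturality F G κ := by
    refine HomologicalComplex.hom_ext _ _ fun n => ?_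
    exact adaptedClass_naturality κ n

end Adapted

/-! ### The comparison quasi-isomorphisms -/

section Comparison

variable {P : Type u} [PartialOrder P] [GradeOrder ℤ P] {F : Pᵒᵖ ⥤ AddCommGrpCat.{w}}

lemma iCycles_adaptedToCycles (n : ℕ) (s : adaptedCochain F n) :
    ((relComplex (filtration P (n + 1)) (filtration P n)).obj F).iCycles n
      (adaptedToCycles F n s) = restrictLayer F n n ⟨s.1, s.2.1⟩ :=
  ConcreteCategory.congr_hom (HomologicalComplex.liftCycles_i
    ((relComplex (filtration P (n + 1)) (filtration P n)).obj F) (adaptedRestrict F n) (n + 1)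
    (by simp) (adaptedRestrict_d n)) s

/-- Every class of `C^n(P; F)` is represented by an adapted cochain, since extending a cocycle of
the layer `(P^n, P^{n-1})` in any way to `P` gives one. -/
lemma adaptedClass_surjective (n : ℕ) : Function.Surjective (adaptedClass F n) := by
  intro z
  obtain ⟨c, rfl⟩ := homologyπ_surjective n z
  obtain ⟨t, ht⟩ := restrictLayer_surjective n n
    (((relComplex (filtration P (n + 1)) (filtration P n)).obj F).iCycles n c)
  have hc := d_iCycles n c
  rw [← ht, relComplex_d] at hc
  let s : adaptedCochain F n := ⟨t.1, t.2, (restrictLayer_eq_zero_iff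
    (⟨diff F _ n t.1, diff_mem F t.2⟩ : filtCochain F n (n + 1))).1 hc⟩
  have hs : adaptedToCycles F n s = c := by
    apply (AddCommGrpCat.mono_iff_injective (HomologicalComplex.iCycles _ n)).1 inferInstance
    exact (iCycles_adaptedToCycles n s).trans ht
  exact ⟨s, congrArg
    (((relComplex (filtration P (n + 1)) (filtration P n)).obj F).homologyπ n) hs⟩

lemma adaptedClass_eq_zero_iff (n : ℕ) (s : adaptedCochain F n) : adaptedClass F n s = 0 ↔
    IsBoundary ((relComplex (filtration P (n + 1)) (filtration P n)).obj F) n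
      (restrictLayer F n n ⟨s.1, s.2.1⟩) := by
  have h := homologyπ_eq_zero_iff n (adaptedToCycles F n s)
  rw [iCycles_adaptedToCycles] at h
  exact h

lemma adaptedClass_zero_eq_zero_iff (s : adaptedCochain F 0) :
    adaptedClass F 0 s = 0 ↔ s.1 ∈ filtCochain F 1 0 :=
  (adaptedClass_eq_zero_iff 0 s).trans
    (restrictLayer_eq_zero_iff (⟨s.1, s.2.1⟩ : filtCochain F 0 0))

lemma adaptedClass_succ_eq_zero_iff (n : ℕ) (s : adaptedCochain F (n + 1)) :
    adaptedClass F (n + 1) s = 0 ↔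
      ∃ t ∈ filtCochain F (n + 1) n, s.1 - diff F _ n t ∈ filtCochain F (n + 2) (n + 1) := by
  have key (t : filtCochain F (n + 1) n) :
      relDiff F _ _ n (restrictLayer F (n + 1) n t) =
          restrictLayer F (n + 1) (n + 1) ⟨s.1, s.2.1⟩ ↔
        s.1 - diff F _ n t.1 ∈ filtCochain F (n + 2) (n + 1) := by
    rw [relDiff_restrictLayer, eq_comm, ← sub_eq_zero, ← map_sub, restrictLayer_eq_zero_iff]
    rfl
  rw [adaptedClass_eq_zero_iff]
  change (∃ y, _) ↔ _
  rw [relComplex_d]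
  constructor
  · rintro ⟨y, hy⟩
    obtain ⟨t, rfl⟩ := restrictLayer_surjective (n + 1) n y
    exact ⟨t.1, t.2, (key t).1 hy⟩
  · rintro ⟨t, ht, h⟩
    exact ⟨restrictLayer F (n + 1) n ⟨t, ht⟩, (key ⟨t, ht⟩).2 h⟩

lemma isBoundary_adaptedComplex_succ_iff (n : ℕ) (s : adaptedCochain F (n + 1)) :
    IsBoundary ((adaptedComplex P).obj F) (n + 1) s ↔
      ∃ t ∈ adaptedCochain F n, diff F _ n t = s.1 := by
  change (∃ y, _) ↔ _
  rw [adaptedComplex_d]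
  exact ⟨fun ⟨t, h⟩ => ⟨t.1, t.2, congrArg Subtype.val h⟩,
    fun ⟨t, ht, h⟩ => ⟨⟨t, ht⟩, Subtype.ext h⟩⟩

lemma adaptedComplex_d_eq_zero_iff (n : ℕ) (s : adaptedCochain F n) :
    ((adaptedComplex P).obj F).d n (n + 1) s = 0 ↔ diff F _ n s.1 = 0 := by
  rw [adaptedComplex_d]
  exact ⟨congrArg Subtype.val, fun h => Subtype.ext h⟩

lemma isBoundary_cellularComplex_succ_iff (n : ℕ)
    (z : (relHS (filtration P (n + 2)) (filtration P (n + 1)) (n + 1)).obj F) :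
    IsBoundary ((cellularComplex P).obj F) (n + 1) z ↔
      ∃ s, adaptedClass F (n + 1) (adaptedDiff F n s) = z := by
  change (∃ y, _) ↔ _
  rw [cellularComplex_d]
  have h (s) := ConcreteCategory.congr_hom (adaptedClass_coboundary (F := F) n) s
  constructor
  · rintro ⟨y, hy⟩
    obtain ⟨s, rfl⟩ := adaptedClass_surjective n y
    exact ⟨s, (h s).symm.trans hy⟩
  · rintro ⟨s, hs⟩
    exact ⟨adaptedClass F n s, (h s).trans hs⟩

lemma mem_adaptedCochain_of_diff_eq_zero {n : ℕ} {s : Cochain F (Set.univ : Set P) n}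
    (hs : s ∈ filtCochain F n n) (hd : diff F _ n s = 0) : s ∈ adaptedCochain F n := by
  refine ⟨hs, ?_⟩
  change diff F _ n s ∈ filtCochain F (n + 1) (n + 1)
  exact hd ▸ zero_mem _

lemma mem_adaptedCochain_of_mem_succ {n : ℕ} {t : Cochain F (Set.univ : Set P) n}
    (ht : t ∈ filtCochain F (n + 1) n) : t ∈ adaptedCochain F n :=
  ⟨filtCochain_anti n.le_succ _ ht, diff_mem F ht⟩

lemma adaptedClass_eq_zero_of_mem_succ {n : ℕ} {t : Cochain F (Set.univ : Set P) n}
    (ht : t ∈ filtCochain F (n + 1) n) :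
    adaptedClass F n ⟨t, mem_adaptedCochain_of_mem_succ ht⟩ = 0 := by
  cases n with
  | zero => exact (adaptedClass_zero_eq_zero_iff _).2 ht
  | succ n => exact (adaptedClass_succ_eq_zero_iff n _).2 ⟨0, zero_mem _, by simpa using ht⟩

/-- A cocycle that is adapted with class zero is the differential of a cochain of the same
filtration: for its degree `n`, it is up to a coboundary a cocycle of filtration `n + 1`, and
`HS^n(P, P^n; F) = 0`. -/
lemma exists_diff_eq_of_adaptedClass_eq_zero (hcell : IsCellular.{u, w} P) {n : ℕ}
    {s : adaptedCochain F (n + 1)} (hs : adaptedClass F (n + 1) s = 0)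
    (hd : diff F _ (n + 1) s.1 = 0) : ∃ t ∈ filtCochain F (n + 1) n, diff F _ n t = s.1 := by
  obtain ⟨t, ht, h⟩ := (adaptedClass_succ_eq_zero_iff n _).1 hs
  obtain ⟨z, hz, e⟩ := exists_diff_eq_of_mem_filtCochain hcell (Nat.lt_succ_self _) h (by
    rw [map_sub, diff_diff, sub_zero, hd])
  exact ⟨t + z, add_mem ht (filtCochain_anti (Nat.le_succ _) _ hz), by
    rw [map_add, e, add_sub_cancel]⟩

/-- The inclusion of the adapted cochains is a quasi-isomorphism: cocycles of degree `n`, and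
cochains of degree `n - 1` with adapted differential, can be pushed up to filtration `n`
respectively `n - 1` by the vanishing of the cohomology of the layers below. -/
lemma isIso_homologyMap_adaptedToComplex (hbdd : BddAbove (Set.range (grade ℤ : P → ℤ)))
    (hcell : IsCellular.{u, w} P) (n : ℕ) :
    IsIso (HomologicalComplex.homologyMap ((adaptedToComplex P).app F) n) := by
  refine isIso_homologyMap _ n ?_ ?_
  · intro (s : Cochain F Set.univ n) hs
    rw [complex_d] at hs
    replace hs : diff F Set.univ n s = 0 := hs
    cases n with
    | zero =>
      exact ⟨(⟨s, mem_adaptedCochain_of_diff_eq_zero (mem_filtCochain_zero hbdd s) hs⟩ :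
        adaptedCochain F 0), (adaptedComplex_d_eq_zero_iff 0 _).2 hs, sub_self s⟩
    | succ n =>
      obtain ⟨t, ht⟩ := exists_sub_diff_mem_of_diff_mem hbdd hcell le_rfl
        (s := s) (hs ▸ zero_mem (filtCochain F (n + 1) (n + 2)))
      have hd : diff F _ (n + 1) (s - diff F _ n t) = 0 := by
        rw [map_sub, hs, diff_diff, sub_zero]
      refine ⟨(⟨s - diff F _ n t, mem_adaptedCochain_of_diff_eq_zero ht hd⟩ :
        adaptedCochain F (n + 1)), (adaptedComplex_d_eq_zero_iff (n + 1) _).2 hd,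
        (isBoundary_complex_succ_iff n (s - diff F _ n t - s)).2 ⟨-t, ?_⟩⟩
      rw [map_neg, sub_sub_cancel_left]
  · intro (s : adaptedCochain F n) hs hb
    cases n with
    | zero => exact Subtype.ext hb
    | succ n =>
      obtain ⟨t, ht⟩ := (isBoundary_complex_succ_iff n s.1).1 hb
      have hs' : diff F Set.univ n t ∈ filtCochain F (n + 1) (n + 1) := ht ▸ s.2.1
      suffices h : ∃ t' ∈ filtCochain F n n, diff F Set.univ n t' = diff F Set.univ n t by
        obtain ⟨t', ht', e⟩ := h
        exact (isBoundary_adaptedComplex_succ_iff n s).2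
          ⟨t', ⟨ht', by rw [← e] at hs'; exact hs'⟩, e.trans ht⟩
      cases n with
      | zero => exact ⟨t, mem_filtCochain_zero hbdd _, rfl⟩
      | succ n =>
        obtain ⟨v, hv⟩ := exists_sub_diff_mem_of_diff_mem hbdd hcell le_rfl
          (s := t) (filtCochain_anti (Nat.le_succ _) _ hs')
        exact ⟨_, hv, by rw [map_sub, diff_diff, sub_zero]⟩

/-- The projection from adapted to cellular cochains is a quasi-isomorphism: it is surjective, and
its kernel is acyclic by `exists_diff_eq_of_adaptedClass_eq_zero`. -/
lemma isIso_homologyMap_adaptedToCellular (hcell : IsCellular.{u, w} P) (n : ℕ) :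
    IsIso (HomologicalComplex.homologyMap ((adaptedToCellular P).app F) n) := by
  refine isIso_homologyMap _ n ?_ ?_
  · intro z hz
    obtain ⟨s, rfl⟩ := adaptedClass_surjective n z
    -- The differential of `s` is adapted with class zero, so it is the differential of some `t` that
    -- does not change the class of `s`; then `s - t` is a cocycle.
    have hds : adaptedClass F (n + 1) (adaptedDiff F n s) = 0 := by
      rw [cellularComplex_d] at hz
      exact (ConcreteCategory.congr_hom (adaptedClass_coboundary n) s).symm.trans hz
    obtain ⟨t, ht, e⟩ := exists_diff_eq_of_adaptedClass_eq_zero hcell hds (diff_diff F _ n s.1)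
    refine ⟨_, (adaptedComplex_d_eq_zero_iff n
      ((s : adaptedCochain F n) - ⟨t, mem_adaptedCochain_of_mem_succ ht⟩)).2 ?_, ?_⟩
    · change diff F _ n (Subtype.val (p := (· ∈ adaptedCochain F n)) s - t) = 0
      rw [map_sub, e]
      exact sub_self _
    · have h' : adaptedClass F n (s - ⟨t, mem_adaptedCochain_of_mem_succ ht⟩ :
          adaptedCochain F n) - adaptedClass F n s = 0 := by
        rw [map_sub, adaptedClass_eq_zero_of_mem_succ ht, sub_zero, sub_self]
      exact (isBoundary_iff n _).2 ⟨0, (map_zero _).trans h'.symm⟩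
  · intro (s : adaptedCochain F n) hs hb
    replace hs := (adaptedComplex_d_eq_zero_iff n s).1 hs
    cases n with
    | zero =>
      exact Subtype.ext (eq_zero_of_mem_filtCochain hcell one_pos
        ((adaptedClass_zero_eq_zero_iff s).1 hb) hs)
    | succ n =>
      obtain ⟨r, hr⟩ := (isBoundary_cellularComplex_succ_iff n (adaptedClass F (n + 1) s)).1 hb
      replace hr : adaptedClass F (n + 1) (s - adaptedDiff F n r) = 0 := by
        rw [map_sub, hr]; exact sub_self _
      obtain ⟨t, ht, e⟩ := exists_diff_eq_of_adaptedClass_eq_zero hcell hr (by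
        change diff F _ (n + 1) (s.1 - diff F _ n r.1) = 0
        rw [map_sub, diff_diff, sub_zero, hs])
      refine (isBoundary_adaptedComplex_succ_iff n s).2
        ⟨r.1 + t, add_mem r.2 (mem_adaptedCochain_of_mem_succ ht), ?_⟩
      rw [map_add, e]
      exact add_sub_cancel (diff F _ n r.1) s.1

end Comparison

end

end PosetCohomology

open PosetCohomology in
theorem theorem3 (P : Type u) [PartialOrder P] [GradeOrder ℤ P]
    (hbdd : BddAbove (Set.range (grade ℤ : P → ℤ)))
    (hfin : IsLocallyFinite P)
    (hcell : IsCellular.{u, w} P) (n : ℕ) :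
    Nonempty (HS.{u, w} P n ≅ HC.{u, w} P n) := by
  let α := Functor.whiskerRight (adaptedToComplex.{u, w} P)
    (HomologicalComplex.homologyFunctor _ _ n)
  let β := Functor.whiskerRight (adaptedToCellular.{u, w} P)
    (HomologicalComplex.homologyFunctor _ _ n)
  have : ∀ F, IsIso (α.app F) := fun F => isIso_homologyMap_adaptedToComplex hbdd hcell n
  have : ∀ F, IsIso (β.app F) := fun F => isIso_homologyMap_adaptedToCellular hcell n
  have hα : IsIso α := NatIso.isIso_of_isIso_app α
  have hβ : IsIso β := NatIso.isIso_of_isIso_app β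
  exact ⟨(@asIso _ _ _ _ α hα).symm ≪≫ @asIso _ _ _ _ β hβ⟩
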